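/- Let $f:[0,1)\to[0,+\infty)$ satisfy, for some $\sigma_c\in(0,+\infty)$: - (f1) $f\in C^2([0,1))$ and $f^{-1}(0)=\{0\}$; - (f2) $\lim_{s\to1^-}(1-s)f(s)=\sigma_c$; - (f3) $\frac{d}{ds}\bigl[(1-s)f(s)\bigr]>0$ for all $s\in(0,1)$; - (f4) $\frac{d}{ds}\Bigl[\frac{(1-s)f'(s)}{f(s)}\Bigr]<0$ for all $s\in(0,1)$; - (f5) $\lim_{s\to1^-}\frac{1}{(1-s)^3}\frac{d}{ds}\bigl[(1-s)f(s)\bigr]=+\infty$; - (f6) the map $s\mapsto\sqrt{s}\,f(1-\sqrt{s})$ is convex on $(0,1]$. For $s\ge0$ let $$g(s)=\inf_{(\alpha,\beta)\in\mathcal U_s}\int_{-\infty}^{+\infty}\Bigl(f^2(\beta)|\alpha'|^2+\frac{(1-\beta)^2}{4}+|\beta'|^2\Bigr)\,dt ,$$ where $\mathcal U_s$ is the set of pairs $(\alpha,\beta)\in H^1_{\mathrm{loc}}(\mathbb R)\times H^1_{\mathrm{loc}}(\mathbb R)$ such that $\alpha'\in L^1(\mathbb R)$, $\bigl|\int_{\mathbb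 R}\alpha'\,dt\bigr|=s$, $0\le\beta\le1$ and $\lim_{|t|\to+\infty}\beta(t)=1$, and where $f^2(\beta)|\alpha'|^2$ is read, at points with $\beta=1$, as $0$ if $\alpha'=0$ and as $+\infty$ if $\alpha'\neq0$. Suppose that, for some $\ell>0$ and $q\in(0,2]$, $$(1-s)f(s)=\sigma_c-\ell(1-s)^q+o\bigl((1-s)^q\bigr)\qquad\text{as }s\to1^- .$$ Then there is $\tilde\ell>0$ such that, with $p=\frac{4+q}{4-q}$, $$g(s)=\sigma_c s-\tilde\ell\,s^p+o(s^p)\qquad\text{as }s\to0^+ .$$ -/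

import Mathlib

open MeasureTheory Filter Topology Asymptotics
open scoped ENNReal ContDiff

/-- The assumptions on the degradation function `f : [0,1) → [0,∞)` with
critical stress `σc`. The function is represented by a map on `ℝ`; every condition only sees its
values on `[0,1)`. -/
structure IsDegradation (f : ℝ → ℝ) (σc : ℝ) : Prop where
  contDiffOn : ContDiffOn ℝ 2 f (Set.Ico 0 1)
  nonneg : ∀ s ∈ Set.Ico (0 : ℝ) 1, 0 ≤ f s
  eq_zero_iff : ∀ s ∈ Set.Ico (0 : ℝ) 1, f s = 0 ↔ s = 0
  critical_pos : 0 < σc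
  tendsto_critical : Tendsto (fun s => (1 - s) * f s) (𝓝[<] 1) (𝓝 σc)
  deriv_pos : ∀ s ∈ Set.Ioo (0 : ℝ) 1, 0 < deriv (fun t => (1 - t) * f t) s
  deriv_neg : ∀ s ∈ Set.Ioo (0 : ℝ) 1, deriv (fun t => (1 - t) * deriv f t / f t) s < 0
  tendsto_deriv : Tendsto (fun s => 1 / (1 - s) ^ 3 * deriv (fun t => (1 - t) * f t) s)
    (𝓝[<] 1) atTop
  convex : ConvexOn ℝ (Set.Ioc 0 1) (fun s => √s * f (1 - √s))

/-- `u ∈ L²_loc(ℝ)`. -/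
def MemL2Loc (u : ℝ → ℝ) : Prop :=
  ∀ K : Set ℝ, IsCompact K → MemLp u 2 (volume.restrict K)

/-- `u` is the continuous representative of an element of `H¹_loc(ℝ)`, and `u'` is (a
representative of) its weak derivative. -/
structure IsH1Loc (u u' : ℝ → ℝ) : Prop where
  continuous : Continuous u
  memL2Loc : MemL2Loc u
  memL2Loc_deriv : MemL2Loc u'
  weak_deriv : ∀ φ : ℝ → ℝ, ContDiff ℝ ∞ φ → HasCompactSupport φ →
    ∫ t, u t * deriv φ t = - ∫ t, u' t * φ t

/-- The pair `(α, β)`, with weak derivatives `α'` and `β'`, belongs to the class `𝓤_s`. -/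
structure IsAdmissible (s : ℝ) (α α' β β' : ℝ → ℝ) : Prop where
  h1_fst : IsH1Loc α α'
  h1_snd : IsH1Loc β β'
  integrable : Integrable α'
  opening : |∫ t, α' t| = s
  mem_Icc : ∀ t, β t ∈ Set.Icc (0 : ℝ) 1
  tendsto_one : Tendsto β (cocompact ℝ) (𝓝 1)

/-- `f²` on `[0,1]`, with the convention `f(1) = +∞` (the limit of `f` at `1`). -/
noncomputable def stiffness (f : ℝ → ℝ) (x : ℝ) : ℝ≥0∞ :=
  if x < 1 then ENNReal.ofReal (f x ^ 2) else ⊤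

/-- The energy `𝒢(α,β) = ∫ f²(β)|α'|² + (1-β)²/4 + |β'|² dt ∈ [0,∞]`. In `ℝ≥0∞` one has
`⊤ * 0 = 0`, so `f²(β)|α'|²` vanishes where `β = 1` and `α' = 0`, and is `+∞` where `β = 1` and
`α' ≠ 0`. -/
noncomputable def profileEnergy (f α' β β' : ℝ → ℝ) : ℝ≥0∞ :=
  ∫⁻ t, (stiffness f (β t) * ENNReal.ofReal (α' t ^ 2)
    + ENNReal.ofReal ((1 - β t) ^ 2 / 4) + ENNReal.ofReal (β' t ^ 2))

/-- The infimum of `𝒢` over `𝓤_s`, as an element of `[0,∞]`. -/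
noncomputable def cohesiveInf (f : ℝ → ℝ) (s : ℝ) : ℝ≥0∞ :=
  ⨅ (α : ℝ → ℝ) (α' : ℝ → ℝ) (β : ℝ → ℝ) (β' : ℝ → ℝ) (_ : IsAdmissible s α α' β β'),
    profileEnergy f α' β β'

/-- The cohesive energy density `g(s) = inf { 𝒢(α,β) : (α,β) ∈ 𝓤_s }` for `s ≥ 0`. (The infimum is finite
for every `s ≥ 0`, so `toReal` only changes its type.) -/
noncomputable def cohesiveDensity (f : ℝ → ℝ) (s : ℝ) : ℝ :=
  (cohesiveInf f s).toReal

/-! Put `x = 1 - β`, `N = ∫ x²`, `D = ∫ x'²`, `C = ∫ x^(2+q)`. The expansion gives `1/f² ≈ x²/σ² +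
(2l/σ³) x^(2+q)` for small `x`. In `f²α'² + θ²/f² ≥ 2θ|α'|` take `θ = σ/2`: the terms `N/4` cancel,
and the energy is at least about `σs + D - κC` with `κ = l/(2σ)`. Equality in this inequality
suggests `α' = x²/(2σ)`, hence `N = 2σs`. To the order needed, `g(s) - σs` is therefore the minimum
of `D - κC` over profiles with `N = 2σs`.

With `a = q/4` and `G` the best constant in the Gagliardo–Nirenberg inequality `C ≤ G D^a N^(1+a)`,
maximizing `κ G N^(1+a) D^a - D` over `D` gives a constant times `N^((1+a)/(1-a))`. This exponent is
`p`, and `l' = powConj a (κG) (2σ)^p`. Neither an optimal profile nor the value of `G` is needed: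
almost optimal profiles, rescaled to prescribed `N` and `D`, suffice.

The two bounds are `le_cohesiveInf` and `cohesiveInf_le`. Both rest on `exists_sharp_constant`, on
the expansion in `exists_sq_bounds`, and on the sup bound `sq_le_sqrt_mul_sqrt`, which keeps `x` in
the range where the expansion holds. -/

/-! ### Local Sobolev functions. -/

theorem memL2Loc_of_continuous {u : ℝ → ℝ} (hu : Continuous u) : MemL2Loc u := by
  intro K hK
  rw [memLp_two_iff_integrable_sq hu.aestronglyMeasurable]
  exact (hu.pow 2).continuousOn.integrableOn_compact hK

theorem MemL2Loc.locallyIntegrable {u : ℝ → ℝ} (hu : MemL2Loc u) : LocallyIntegrable u := by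
  rw [locallyIntegrable_iff]
  intro K hK
  have : IsFiniteMeasure (volume.restrict K) := ⟨by simpa using hK.measure_lt_top⟩
  exact (hu K hK).integrable (by norm_num)

theorem integral_deriv_eq_zero_of_hasCompactSupport {φ : ℝ → ℝ} (hφ : ContDiff ℝ ∞ φ)
    (hc : HasCompactSupport φ) : ∫ t, deriv φ t = 0 :=
  integral_eq_zero_of_hasDerivAt_of_integrable
    (fun t => ((hφ.differentiable (by simp)) t).hasDerivAt)
    ((hφ.continuous_deriv (by simp)).integrable_of_hasCompactSupport hc.deriv)
    (hφ.continuous.integrable_of_hasCompactSupport hc)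

theorem isH1Loc_of_hasDerivAt {u u' : ℝ → ℝ} (hu : ∀ t, HasDerivAt u (u' t) t)
    (hu' : Continuous u') : IsH1Loc u u' := by
  have hc : Continuous u := continuous_iff_continuousAt.2 fun t => (hu t).continuousAt
  refine ⟨hc, memL2Loc_of_continuous hc, memL2Loc_of_continuous hu', fun φ hφ hφc => ?_⟩
  have hd : Continuous (deriv φ) := hφ.continuous_deriv (by simp)
  exact integral_mul_deriv_eq_deriv_mul_of_integrable (fun t _ => hu t)
    (fun t _ => ((hφ.differentiable (by simp)) t).hasDerivAt)
    ((hc.mul hd).integrable_of_hasCompactSupport hφc.deriv.mul_left)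
    ((hu'.mul hφ.continuous).integrable_of_hasCompactSupport hφc.mul_left)
    ((hc.mul hφ.continuous).integrable_of_hasCompactSupport hφc.mul_left)

theorem IsH1Loc.one_sub {u u' : ℝ → ℝ} (h : IsH1Loc u u') :
    IsH1Loc (fun t => 1 - u t) (fun t => -u' t) := by
  have hc : Continuous fun t => 1 - u t := continuous_const.sub h.continuous
  refine ⟨hc, memL2Loc_of_continuous hc, fun K hK => (h.memL2Loc_deriv K hK).neg,
    fun φ hφ hφc => ?_⟩
  have hd : Continuous (deriv φ) := hφ.continuous_deriv (by simp)
  have e : (fun t => (1 - u t) * deriv φ t) = fun t => deriv φ t - u t * deriv φ t := by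
    ext t; ring
  have hi : Integrable fun t => u t * deriv φ t :=
    (h.continuous.mul hd).integrable_of_hasCompactSupport hφc.deriv.mul_left
  rw [e, integral_sub (hd.integrable_of_hasCompactSupport hφc.deriv) hi,
    integral_deriv_eq_zero_of_hasCompactSupport hφ hφc, h.weak_deriv φ hφ hφc]
  simp [integral_neg]

/-! ### Smooth ramps and increments of Sobolev functions. -/

/-- The smooth ramp which is `0` on `(-∞, a]` and `1` on `[a + e, ∞)`. -/
noncomputable def ramp (a e t : ℝ) : ℝ := Real.smoothTransition ((t - a) / e)

theorem ramp_contDiff (a e : ℝ) : ContDiff ℝ ∞ (ramp a e) :=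
  Real.smoothTransition.contDiff.comp ((contDiff_id.sub contDiff_const).div_const e)

theorem ramp_of_le {a e t : ℝ} (he : 0 < e) (h : t ≤ a) : ramp a e t = 0 :=
  Real.smoothTransition.zero_of_nonpos (div_nonpos_of_nonpos_of_nonneg (by linarith) he.le)

theorem ramp_of_ge {a e t : ℝ} (he : 0 < e) (h : a + e ≤ t) : ramp a e t = 1 :=
  Real.smoothTransition.one_of_one_le (by rw [le_div_iff₀ he]; linarith)

theorem ramp_monotone {a e : ℝ} (he : 0 < e) : Monotone (ramp a e) := fun s t h =>
  Real.smoothTransition.monotone (by gcongr)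

theorem ramp_anti {a b e : ℝ} (he : 0 < e) (hab : a ≤ b) (t : ℝ) : ramp b e t ≤ ramp a e t :=
  Real.smoothTransition.monotone (by gcongr)

theorem deriv_ramp_eq_zero {a e t : ℝ} (he : 0 < e) (h : t ∉ Set.Icc a (a + e)) :
    deriv (ramp a e) t = 0 := by
  rcases lt_or_ge t a with h1 | h1
  · have : ramp a e =ᶠ[𝓝 t] fun _ => 0 := by
      filter_upwards [Iio_mem_nhds h1] with s hs using ramp_of_le he (le_of_lt hs)
    rw [this.deriv_eq]; simp
  · have h2 : a + e < t := by by_contra h2; exact h ⟨h1, by linarith⟩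
    have : ramp a e =ᶠ[𝓝 t] fun _ => 1 := by
      filter_upwards [Ioi_mem_nhds h2] with s hs using ramp_of_ge he (le_of_lt hs)
    rw [this.deriv_eq]; simp

theorem hasCompactSupport_deriv_ramp {a e : ℝ} (he : 0 < e) :
    HasCompactSupport (deriv (ramp a e)) :=
  HasCompactSupport.intro isCompact_Icc fun _ h => deriv_ramp_eq_zero he h

theorem continuous_deriv_ramp (a e : ℝ) : Continuous (deriv (ramp a e)) :=
  (ramp_contDiff a e).continuous_deriv (by simp)

theorem integral_deriv_ramp {a e : ℝ} (he : 0 < e) : ∫ t, deriv (ramp a e) t = 1 := by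
  have h0 : Tendsto (ramp a e) atBot (𝓝 0) :=
    tendsto_const_nhds.congr' (by
      filter_upwards [eventually_le_atBot a] with t ht using (ramp_of_le he ht).symm)
  have h1 : Tendsto (ramp a e) atTop (𝓝 1) :=
    tendsto_const_nhds.congr' (by
      filter_upwards [eventually_ge_atTop (a + e)] with t ht using (ramp_of_ge he ht).symm)
  rw [integral_of_hasDerivAt_of_tendsto
    (fun t => (((ramp_contDiff a e).differentiable (by simp)) t).hasDerivAt)
    ((continuous_deriv_ramp a e).integrable_of_hasCompactSupport
      (hasCompactSupport_deriv_ramp he)) h0 h1]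
  simp

/-- The derivative of a ramp is a nonnegative mollifier of mass one on `[a, a + e]`, so it nearly
evaluates `u` at `a`. -/
theorem abs_integral_mul_deriv_ramp_sub_le {u : ℝ → ℝ} (hu : Continuous u) {a e η : ℝ}
    (he : 0 < e) (h : ∀ t ∈ Set.Icc a (a + e), |u t - u a| ≤ η) :
    |(∫ t, u t * deriv (ramp a e) t) - u a| ≤ η := by
  have hd := continuous_deriv_ramp a e
  have hs := hasCompactSupport_deriv_ramp (a := a) he
  have i0 := hd.integrable_of_hasCompactSupport (μ := volume) hs
  have i1 : Integrable fun t => u t * deriv (ramp a e) t :=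
    (hu.mul hd).integrable_of_hasCompactSupport hs.mul_left
  have e1 : (∫ t, u t * deriv (ramp a e) t) - u a
      = ∫ t, (u t - u a) * deriv (ramp a e) t := by
    simp_rw [sub_mul]
    rw [integral_sub i1 (i0.const_mul _), integral_const_mul, integral_deriv_ramp he, mul_one]
  rw [e1, ← Real.norm_eq_abs]
  calc _ ≤ ∫ t, η * deriv (ramp a e) t := by
        refine norm_integral_le_of_norm_le (i0.const_mul _) (ae_of_all _ fun t => ?_)
        have hn : 0 ≤ deriv (ramp a e) t := (ramp_monotone he).deriv_nonneg
        rw [Real.norm_eq_abs, abs_mul, abs_of_nonneg hn]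
        by_cases ht : t ∈ Set.Icc a (a + e)
        · exact mul_le_mul_of_nonneg_right (h t ht) hn
        · simp [deriv_ramp_eq_zero he ht]
    _ = η := by rw [integral_const_mul, integral_deriv_ramp he, mul_one]

/-- Testing the weak derivative with a difference of two ramps recovers `u b - u a` as `e → 0`.
Young's inequality with free weight `τ` replaces Cauchy–Schwarz, so no square roots appear. -/
theorem abs_sub_le_of_weak_deriv {u u' : ℝ → ℝ} (h : IsH1Loc u u')
    (hi : Integrable fun t => u' t ^ 2) {a b τ : ℝ} (hab : a ≤ b) (hτ : 0 < τ) :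
    |u b - u a| ≤ (τ * ∫ t, u' t ^ 2) / 2 + (b - a) / τ / 2 := by
  refine le_of_forall_pos_le_add fun η hη => ?_
  set r := η / 4 with hr
  have hr0 : 0 < r := by positivity
  obtain ⟨δ₁, hδ₁, h1⟩ := Metric.continuous_iff.1 h.continuous a r hr0
  obtain ⟨δ₂, hδ₂, h2⟩ := Metric.continuous_iff.1 h.continuous b r hr0
  obtain ⟨e, he, he1, he2, he3⟩ : ∃ e : ℝ, 0 < e ∧ e < δ₁ ∧ e < δ₂ ∧ e ≤ 2 * τ * r := by
    refine ⟨min (δ₁ / 2) (min (δ₂ / 2) (2 * τ * r)), by positivity, ?_, ?_, ?_⟩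
    · exact (min_le_left _ _).trans_lt (by linarith)
    · exact ((min_le_right _ _).trans (min_le_left _ _)).trans_lt (by linarith)
    · exact (min_le_right _ _).trans (min_le_right _ _)
  have ha := abs_integral_mul_deriv_ramp_sub_le h.continuous he (a := a) (η := r) fun t ht => by
    rw [← Real.dist_eq]
    refine (h1 t ?_).le
    rw [Real.dist_eq, abs_lt]; constructor <;> linarith [ht.1, ht.2]
  have hb := abs_integral_mul_deriv_ramp_sub_le h.continuous he (a := b) (η := r) fun t ht => by
    rw [← Real.dist_eq]
    refine (h2 t ?_).le
    rw [Real.dist_eq, abs_lt]; constructor <;> linarith [ht.1, ht.2]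
  set φ : ℝ → ℝ := fun t => ramp a e t - ramp b e t with hφ
  have hφd : ContDiff ℝ ∞ φ := (ramp_contDiff a e).sub (ramp_contDiff b e)
  have hφ0 : ∀ t, t ∉ Set.Icc a (b + e) → φ t = 0 := fun t ht => by
    rcases lt_or_ge t a with h3 | h3
    · simp [hφ, ramp_of_le he h3.le, ramp_of_le he (h3.le.trans hab)]
    · have h4 : b + e < t := by by_contra h4; exact ht ⟨h3, by linarith⟩
      simp [hφ, ramp_of_ge he h4.le, ramp_of_ge he (show a + e ≤ t by linarith)]
  have hφc : HasCompactSupport φ := HasCompactSupport.intro isCompact_Icc hφ0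
  have hφn : ∀ t, 0 ≤ φ t := fun t => sub_nonneg.2 (ramp_anti he hab t)
  have hφ1 : ∀ t, φ t ≤ 1 := fun t => by
    have := Real.smoothTransition.le_one ((t - a) / e)
    have := Real.smoothTransition.nonneg ((t - b) / e)
    simp only [hφ, ramp]; linarith
  have hw := h.weak_deriv φ hφd hφc
  have hde : ∀ t, deriv φ t = deriv (ramp a e) t - deriv (ramp b e) t := fun t =>
    deriv_sub ((ramp_contDiff a e).differentiable (by simp) t)
      ((ramp_contDiff b e).differentiable (by simp) t)
  have hl : ∫ t, u t * deriv φ t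
      = (∫ t, u t * deriv (ramp a e) t) - ∫ t, u t * deriv (ramp b e) t := by
    simp_rw [hde, mul_sub]
    exact integral_sub
      ((h.continuous.mul (continuous_deriv_ramp a e)).integrable_of_hasCompactSupport
        (hasCompactSupport_deriv_ramp he).mul_left)
      ((h.continuous.mul (continuous_deriv_ramp b e)).integrable_of_hasCompactSupport
        (hasCompactSupport_deriv_ramp he).mul_left)
  have hib : Integrable ((Set.Icc a (b + e)).indicator fun _ => 1 / (2 * τ)) :=
    (integrable_indicator_iff measurableSet_Icc).2 (integrableOn_const (by simp))
  have hbound : |∫ t, u' t * φ t| ≤ (τ * ∫ t, u' t ^ 2) / 2 + (b + e - a) / τ / 2 := by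
    rw [← Real.norm_eq_abs]
    calc _ ≤ ∫ t, (τ / 2 * u' t ^ 2 + (Set.Icc a (b + e)).indicator (fun _ => 1 / (2 * τ)) t) := by
          refine norm_integral_le_of_norm_le ((hi.const_mul _).add hib) (ae_of_all _ fun t => ?_)
          by_cases ht : t ∈ Set.Icc a (b + e)
          · rw [Set.indicator_of_mem ht, Real.norm_eq_abs, abs_mul, abs_of_nonneg (hφn t)]
            calc |u' t| * φ t ≤ |u' t| * 1 := by gcongr; exact hφ1 t
              _ ≤ τ / 2 * |u' t| ^ 2 + 1 / (2 * τ) := by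
                have : τ / 2 * |u' t| ^ 2 + 1 / (2 * τ) - |u' t| * 1
                    = (τ * |u' t| - 1) ^ 2 / (2 * τ) := by field_simp; ring
                have : 0 ≤ (τ * |u' t| - 1) ^ 2 / (2 * τ) := by positivity
                linarith
              _ = _ := by rw [sq_abs]
          · rw [hφ0 t ht, Set.indicator_of_notMem ht]
            simp only [mul_zero, norm_zero, add_zero]; positivity
      _ = _ := by
          rw [integral_add (hi.const_mul _) hib, integral_const_mul,
            integral_indicator measurableSet_Icc, setIntegral_const]
          simp only [smul_eq_mul, measureReal_def, Real.volume_Icc]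
          rw [ENNReal.toReal_ofReal (by linarith)]
          field_simp
  have h5 : e / τ / 2 ≤ r := by
    rw [div_div, div_le_iff₀ (by positivity)]; linarith
  have h6 : (b + e - a) / τ / 2 = (b - a) / τ / 2 + e / τ / 2 := by ring
  rw [hl] at hw
  rw [abs_le] at ha hb hbound ⊢
  constructor <;> linarith [ha.1, ha.2, hb.1, hb.2, hbound.1, hbound.2]

/-! ### Profiles, sup bound, scaling and the Gagliardo–Nirenberg constant. -/

/-- Nonnegative functions in `H¹(ℝ)`, vanishing at infinity. -/
structure IsProfile (x x' : ℝ → ℝ) : Prop where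
  h1 : IsH1Loc x x'
  nonneg : ∀ t, 0 ≤ x t
  tendsto_zero : Tendsto x (cocompact ℝ) (𝓝 0)
  integrable_sq : Integrable fun t => x t ^ 2
  integrable_sq_deriv : Integrable fun t => x' t ^ 2

/-- On an interval of length `n / d` starting at `t`, the increments of `x` are at most `√(n d)`.
Averaging `x t ^ 2 ≤ 2 x v ^ 2 + 2 n d` over it bounds the first term by `2 n d` as well. -/
theorem sq_le_of_integral_sq_le {x x' : ℝ → ℝ} (h : IsH1Loc x x')
    (hN : Integrable fun t => x t ^ 2) (hD : Integrable fun t => x' t ^ 2) {n d : ℝ}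
    (hn : 0 < n) (hd : 0 < d) (hNn : ∫ t, x t ^ 2 ≤ n ^ 2) (hDd : ∫ t, x' t ^ 2 ≤ d ^ 2) (t : ℝ) :
    x t ^ 2 ≤ 4 * n * d := by
  set ρ := √(n / d) with hρ
  have hρ0 : 0 < ρ := by positivity
  have hρ2 : ρ ^ 2 = n / d := Real.sq_sqrt (by positivity)
  have key : ∀ v ∈ Set.Icc t (t + ρ ^ 2), x t ^ 2 ≤ 2 * x v ^ 2 + 2 * (ρ * d) ^ 2 := by
    intro v hv
    have h1 := abs_sub_le_of_weak_deriv h hD hv.1 (τ := ρ / d) (by positivity)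
    have h2 : ρ / d * ∫ t, x' t ^ 2 ≤ ρ * d := by
      calc _ ≤ ρ / d * d ^ 2 := by gcongr
        _ = ρ * d := by field_simp
    have h3 : (v - t) / (ρ / d) ≤ ρ * d := by
      rw [div_le_iff₀ (by positivity)]
      have : ρ * d * (ρ / d) = ρ ^ 2 := by field_simp
      rw [this]; linarith [hv.2]
    have h4 : |x v - x t| ≤ ρ * d := by linarith
    have h5 : (x v - x t) ^ 2 ≤ (ρ * d) ^ 2 := sq_le_sq.2 (h4.trans (le_abs_self _))
    nlinarith [sq_nonneg (x t - 2 * x v)]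
  have hc := h.continuous
  have h6 : ρ ^ 2 * x t ^ 2 ≤ 2 * n ^ 2 + ρ ^ 2 * (2 * (ρ * d) ^ 2) := by
    have h7 : ∫ v in Set.Icc t (t + ρ ^ 2), x t ^ 2
        ≤ ∫ v in Set.Icc t (t + ρ ^ 2), (2 * x v ^ 2 + 2 * (ρ * d) ^ 2) :=
      setIntegral_mono_on continuous_const.continuousOn.integrableOn_Icc
        (Continuous.integrableOn_Icc (by fun_prop)) measurableSet_Icc key
    have h8 : ∫ v in Set.Icc t (t + ρ ^ 2), x v ^ 2 ≤ ∫ v, x v ^ 2 :=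
      setIntegral_le_integral hN (ae_of_all _ fun v => sq_nonneg _)
    rw [integral_add (hN.integrableOn.const_mul 2) continuous_const.continuousOn.integrableOn_Icc,
      integral_const_mul, setIntegral_const, setIntegral_const] at h7
    simp only [smul_eq_mul, measureReal_def, Real.volume_Icc] at h7
    rw [ENNReal.toReal_ofReal (by nlinarith)] at h7
    have : t + ρ ^ 2 - t = ρ ^ 2 := by ring
    rw [this] at h7
    linarith
  have h9 : ρ ^ 2 * (4 * n * d) = 2 * n ^ 2 + ρ ^ 2 * (2 * (ρ * d) ^ 2) := by
    rw [mul_pow, hρ2]; field_simp; ring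
  exact le_of_mul_le_mul_left (h9 ▸ h6) (by positivity)

theorem sq_le_sqrt_mul_sqrt {x x' : ℝ → ℝ} (h : IsH1Loc x x')
    (hN : Integrable fun t => x t ^ 2) (hD : Integrable fun t => x' t ^ 2) (t : ℝ) :
    x t ^ 2 ≤ 4 * √(∫ t, x t ^ 2) * √(∫ t, x' t ^ 2) := by
  set N := ∫ t, x t ^ 2
  set D := ∫ t, x' t ^ 2
  have hN0 : 0 ≤ N := integral_nonneg fun t => sq_nonneg _
  have hD0 : 0 ≤ D := integral_nonneg fun t => sq_nonneg _
  -- Adding `η > 0` to both roots covers the cases where one of the integrals vanishes.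
  have hlim : Tendsto (fun η : ℝ => 4 * (√N + η) * (√D + η)) (𝓝[>] 0) (𝓝 (4 * √N * √D)) := by
    have : Continuous fun η : ℝ => 4 * (√N + η) * (√D + η) := by fun_prop
    have h2 := this.tendsto 0
    simp only [add_zero] at h2
    exact h2.mono_left nhdsWithin_le_nhds
  refine ge_of_tendsto hlim ?_
  filter_upwards [self_mem_nhdsWithin] with η hη
  have hη : 0 < η := hη
  refine sq_le_of_integral_sq_le h hN hD (by positivity) (by positivity) ?_ ?_ t
  · nlinarith [Real.sq_sqrt hN0, Real.sqrt_nonneg N]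
  · nlinarith [Real.sq_sqrt hD0, Real.sqrt_nonneg D]

namespace IsProfile

variable {x x' : ℝ → ℝ}

theorem rpow_le (h : IsProfile x x') {q : ℝ} (hq : 0 < q) (t : ℝ) :
    x t ^ q ≤ (4 * √(∫ t, x t ^ 2) * √(∫ t, x' t ^ 2)) ^ (q / 2) := by
  have h1 := Real.rpow_le_rpow (sq_nonneg _)
    (sq_le_sqrt_mul_sqrt h.h1 h.integrable_sq h.integrable_sq_deriv t) (z := q / 2) (by positivity)
  rwa [← Real.rpow_natCast, ← Real.rpow_mul (h.nonneg t), Nat.cast_ofNat,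
    mul_div_cancel₀ _ two_ne_zero] at h1

theorem rpow_two_add (h : IsProfile x x') {q : ℝ} (hq : 0 < q) (t : ℝ) :
    x t ^ (2 + q) = x t ^ 2 * x t ^ q := by
  rw [Real.rpow_add' (h.nonneg t) (by positivity)]; norm_cast

theorem integrable_rpow (h : IsProfile x x') {q : ℝ} (hq : 0 < q) :
    Integrable fun t => x t ^ (2 + q) := by
  have hc := h.h1.continuous
  refine (h.integrable_sq.const_mul
    ((4 * √(∫ t, x t ^ 2) * √(∫ t, x' t ^ 2)) ^ (q / 2))).mono'
    (hc.rpow_const fun t => Or.inr (by positivity)).aestronglyMeasurable (ae_of_all _ fun t => ?_)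
  have h0 := h.nonneg t
  rw [Real.norm_eq_abs, abs_of_nonneg (by positivity), h.rpow_two_add hq, mul_comm]
  gcongr
  exact h.rpow_le hq t

/-- The Gagliardo–Nirenberg inequality. -/
theorem integral_rpow_le (h : IsProfile x x') {q : ℝ} (hq : 0 < q) :
    ∫ t, x t ^ (2 + q)
      ≤ 4 ^ (q / 2) * (∫ t, x' t ^ 2) ^ (q / 4) * (∫ t, x t ^ 2) ^ (1 + q / 4) := by
  have hN0 : 0 ≤ ∫ t, x t ^ 2 := integral_nonneg fun t => sq_nonneg _
  have hD0 : 0 ≤ ∫ t, x' t ^ 2 := integral_nonneg fun t => sq_nonneg _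
  calc _ ≤ ∫ t, (4 * √(∫ t, x t ^ 2) * √(∫ t, x' t ^ 2)) ^ (q / 2) * x t ^ 2 := by
        refine integral_mono (h.integrable_rpow hq) (h.integrable_sq.const_mul _) fun t => ?_
        simp only
        rw [h.rpow_two_add hq, mul_comm]
        gcongr
        exact h.rpow_le hq t
    _ = _ := by
        rw [integral_const_mul, Real.mul_rpow (by positivity) (by positivity),
          Real.mul_rpow (by positivity) (by positivity), Real.sqrt_eq_rpow, Real.sqrt_eq_rpow,
          ← Real.rpow_mul hN0, ← Real.rpow_mul hD0, Real.rpow_add' hN0 (by positivity),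
          Real.rpow_one]
        have : 1 / 2 * (q / 2) = q / 4 := by ring
        rw [this]; ring

theorem scale (h : IsProfile x x') {c m : ℝ} (hc : 0 < c) (hm : 0 < m) :
    IsProfile (fun t => c * x (m * t)) (fun t => c * m * x' (m * t)) := by
  have hcont : Continuous fun t => c * x (m * t) :=
    continuous_const.mul (h.h1.continuous.comp (continuous_const.mul continuous_id))
  have hN : Integrable fun t => (c * x (m * t)) ^ 2 := by
    simp_rw [mul_pow]; exact (h.integrable_sq.comp_mul_left' hm.ne').const_mul _
  have hD : Integrable fun t => (c * m * x' (m * t)) ^ 2 := by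
    simp_rw [mul_pow _ (x' _)]; exact (h.integrable_sq_deriv.comp_mul_left' hm.ne').const_mul _
  have hmeas : AEStronglyMeasurable fun t => c * m * x' (m * t) := by
    refine AEStronglyMeasurable.const_mul ?_ _
    refine h.h1.memL2Loc_deriv.locallyIntegrable.aestronglyMeasurable.comp_quasiMeasurePreserving
      ⟨measurable_const_mul m, ?_⟩
    rw [Real.map_volume_mul_left hm.ne']
    exact Measure.smul_absolutelyContinuous
  refine ⟨⟨hcont, memL2Loc_of_continuous hcont,
    fun K _ => ((memLp_two_iff_integrable_sq hmeas).2 hD).restrict K, fun φ hφ hφc => ?_⟩,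
    fun t => mul_nonneg hc.le (h.nonneg _), ?_, hN, hD⟩
  · set ψ : ℝ → ℝ := fun t => φ (m⁻¹ * t) with hψ
    have hψd : ContDiff ℝ ∞ ψ := hφ.comp (contDiff_const.mul contDiff_id)
    have hψc : HasCompactSupport ψ :=
      hφc.comp_homeomorph (Homeomorph.mulLeft₀ m⁻¹ (inv_ne_zero hm.ne'))
    have hw := h.h1.weak_deriv ψ hψd hψc
    have hde : ∀ t, deriv ψ t = m⁻¹ * deriv φ (m⁻¹ * t) := fun t => by
      rw [hψ, deriv_comp_mul_left]; simp
    have e1 := Measure.integral_comp_mul_left (fun t => x t * deriv ψ t) m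
    have e2 := Measure.integral_comp_mul_left (fun t => x' t * ψ t) m
    have f1 : ∀ t, c * x (m * t) * deriv φ t = c * m * (x (m * t) * deriv ψ (m * t)) := fun t => by
      rw [hde, inv_mul_cancel_left₀ hm.ne']; field_simp
    have f2 : ∀ t, c * m * x' (m * t) * φ t = c * m * (x' (m * t) * ψ (m * t)) := fun t => by
      simp only [hψ]; rw [inv_mul_cancel_left₀ hm.ne']; ring
    simp_rw [f1, f2]
    rw [integral_const_mul, integral_const_mul, e1, e2, hw, smul_neg, mul_neg]
  · have h1 : Tendsto (fun t => m * t) (cocompact ℝ) (cocompact ℝ) :=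
      (Homeomorph.mulLeft₀ m hm.ne').isClosedEmbedding.tendsto_cocompact
    simpa using (h.tendsto_zero.comp h1).const_mul c

theorem integral_scale {c m : ℝ} (hm : 0 < m) :
    ∫ t, (c * x (m * t)) ^ 2 = c ^ 2 / m * ∫ t, x t ^ 2 := by
  simp_rw [mul_pow]
  rw [integral_const_mul, Measure.integral_comp_mul_left (fun t => x t ^ 2) m,
    abs_of_pos (by positivity), smul_eq_mul]
  ring

theorem integral_rpow_scale (h : IsProfile x x') {c m r : ℝ} (hc : 0 < c) (hm : 0 < m) :
    ∫ t, (c * x (m * t)) ^ r = c ^ r / m * ∫ t, x t ^ r := by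
  have : ∀ t, (c * x (m * t)) ^ r = c ^ r * x (m * t) ^ r := fun t =>
    Real.mul_rpow hc.le (h.nonneg _)
  simp_rw [this]
  rw [integral_const_mul, Measure.integral_comp_mul_left (fun t => x t ^ r) m,
    abs_of_pos (by positivity), smul_eq_mul]
  ring

end IsProfile

/-- A smooth bump; it forces the best Gagliardo–Nirenberg constant to be positive. -/
theorem exists_isProfile : ∃ x x' : ℝ → ℝ, IsProfile x x' ∧ ∀ r : ℝ, 0 < r → 0 < ∫ t, x t ^ r := by
  obtain ⟨φ, h1, hc, hφ, h01, hx⟩ := exists_contDiff_tsupport_subset (E := ℝ) (n := (⊤ : ℕ∞))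
    (s := Set.univ) (x := 0) univ_mem
  have hn : ∀ t, 0 ≤ φ t := fun t => (h01 (Set.mem_range_self t)).1
  have hd := hφ.continuous_deriv (by simp)
  refine ⟨φ, deriv φ, ⟨isH1Loc_of_hasDerivAt
    (fun t => ((hφ.differentiable (by simp)) t).hasDerivAt) hd, hn, ?_, ?_, ?_⟩, fun r hr => ?_⟩
  · exact hc.is_zero_at_infty
  · exact (hφ.continuous.pow 2).integrable_of_hasCompactSupport
      (hc.mono' fun t ht => subset_tsupport _ fun h0 => ht (by simp [h0]))
  · exact (hd.pow 2).integrable_of_hasCompactSupport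
      (hc.deriv.mono' fun t ht => subset_tsupport _ fun h0 => ht (by simp [h0]))
  · exact Continuous.integral_pos_of_hasCompactSupport_nonneg_nonzero (x := (0 : ℝ))
      (hφ.continuous.rpow_const fun _ => Or.inr hr.le)
      (hc.mono' fun t ht => subset_tsupport _ fun h0 => ht (by simp [h0, Real.zero_rpow hr.ne']))
      (fun t => Real.rpow_nonneg (hn t) r) (by simp [hx])

/-- Existence of a least constant in the Gagliardo–Nirenberg inequality. -/
theorem exists_sharp_constant {q : ℝ} (hq : 0 < q) : ∃ G : ℝ, 0 < G ∧
    (∀ x x', IsProfile x x' → ∫ t, x t ^ (2 + q)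
      ≤ G * (∫ t, x' t ^ 2) ^ (q / 4) * (∫ t, x t ^ 2) ^ (1 + q / 4)) ∧
    ∀ G' < G, 0 ≤ G' → ∃ x x', IsProfile x x' ∧ 0 < ∫ t, x t ^ 2 ∧ 0 < ∫ t, x' t ^ 2 ∧
      G' * (∫ t, x' t ^ 2) ^ (q / 4) * (∫ t, x t ^ 2) ^ (1 + q / 4) < ∫ t, x t ^ (2 + q) := by
  set S : Set ℝ := {K | 0 ≤ K ∧ ∀ x x', IsProfile x x' → ∫ t, x t ^ (2 + q)
      ≤ K * (∫ t, x' t ^ 2) ^ (q / 4) * (∫ t, x t ^ 2) ^ (1 + q / 4)} with hS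
  have hbdd : BddBelow S := ⟨0, fun K hK => hK.1⟩
  have hne : S.Nonempty := ⟨4 ^ (q / 2), by positivity, fun x x' h => h.integral_rpow_le hq⟩
  -- Admissible constants form a closed set, so the infimum is itself admissible.
  have hcl : IsClosed S := by
    rw [hS, Set.ofPred_and]
    refine isClosed_Ici.inter ?_
    simp_rw [Set.ofPred_forall]
    refine isClosed_iInter fun x => isClosed_iInter fun x' => isClosed_iInter fun _ => ?_
    exact isClosed_le continuous_const (by fun_prop)
  have hmem := hcl.csInf_mem hne hbdd
  refine ⟨sInf S, ?_, hmem.2, fun G' hG' hG0 => ?_⟩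
  · refine hmem.1.lt_of_ne fun h0 => ?_
    obtain ⟨x, x', h, hp⟩ := exists_isProfile
    have h1 := hmem.2 x x' h
    rw [← h0] at h1
    simp only [zero_mul] at h1
    exact absurd (hp (2 + q) (by positivity)) h1.not_gt
  · have h1 : G' ∉ S := fun h => absurd (csInf_le hbdd h) hG'.not_ge
    simp only [hS, Set.mem_ofPred_eq, not_and, not_forall, not_le] at h1
    obtain ⟨x, x', h, h2⟩ := h1 hG0
    have hN0 : 0 ≤ ∫ t, x t ^ 2 := integral_nonneg fun t => sq_nonneg _
    have hD0 : 0 ≤ ∫ t, x' t ^ 2 := integral_nonneg fun t => sq_nonneg _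
    have h3 := h.integral_rpow_le hq
    have h4 : 0 < ∫ t, x t ^ (2 + q) := lt_of_le_of_lt (by positivity) h2
    -- If `N` or `D` vanished, the inequality with the crude constant would make `∫ x^(2+q)` vanish
    -- too.
    refine ⟨x, x', h, hN0.lt_of_ne fun h0 => ?_, hD0.lt_of_ne fun h0 => ?_, h2⟩
    · rw [← h0, Real.zero_rpow (by positivity)] at h3; simp only [mul_zero] at h3; linarith
    · rw [← h0, Real.zero_rpow (by positivity)] at h3
      simp only [mul_zero, zero_mul] at h3; linarith

/-! ### Optimization in the Dirichlet energy. -/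

/-- The maximum over `D ≥ 0` of `R * D ^ a - D`. -/
noncomputable def powConj (a R : ℝ) : ℝ := (1 - a) * (R * a ^ a) ^ (1 / (1 - a))

theorem rpow_one_div_one_sub_eq {a B : ℝ} (ha1 : a < 1) (hB : 0 ≤ B) :
    (B ^ (1 / (1 - a))) ^ (1 - a) = B := by
  rw [← Real.rpow_mul hB, one_div_mul_cancel (by linarith), Real.rpow_one]

theorem mul_rpow_sub_le_powConj {a R D : ℝ} (ha : 0 < a) (ha1 : a < 1) (hR : 0 ≤ R) (hD : 0 ≤ D) :
    R * D ^ a - D ≤ powConj a R := by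
  have hRa : 0 ≤ R * a ^ a := by positivity
  -- Weighted AM–GM with weights `a` and `1 - a`; equality holds at `D = a (R a^a)^(1/(1-a))`.
  have h := Real.geom_mean_le_arith_mean2_weighted (w₁ := a) (w₂ := 1 - a) (p₁ := D / a)
    (p₂ := (R * a ^ a) ^ (1 / (1 - a))) ha.le (by linarith) (by positivity) (by positivity)
    (by ring)
  rw [rpow_one_div_one_sub_eq ha1 hRa, mul_div_cancel₀ _ ha.ne', Real.div_rpow hD ha.le] at h
  have : D ^ a / a ^ a * (R * a ^ a) = R * D ^ a := by
    have : a ^ a ≠ 0 := by positivity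
    field_simp
  rw [this] at h
  unfold powConj
  linarith

theorem mul_rpow_sub_eq_powConj {a R : ℝ} (ha : 0 < a) (ha1 : a < 1) (hR : 0 < R) :
    R * (a * (R * a ^ a) ^ (1 / (1 - a))) ^ a - a * (R * a ^ a) ^ (1 / (1 - a))
      = powConj a R := by
  have hRa : 0 < R * a ^ a := by positivity
  have h1 := rpow_one_div_one_sub_eq ha1 hRa.le
  unfold powConj
  set B := (R * a ^ a) ^ (1 / (1 - a)) with hB
  have hB0 : 0 < B := by positivity
  rw [Real.mul_rpow ha.le hB0.le, ← mul_assoc, ← h1, ← Real.rpow_add hB0, sub_add_cancel,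
    Real.rpow_one]
  ring

/-- With `a = q / 4`, this homogeneity is the origin of the exponent `p`. -/
theorem powConj_mul_rpow {a y n : ℝ} (ha : 0 < a) (hy : 0 ≤ y) (hn : 0 ≤ n) :
    powConj a (y * n ^ (1 + a)) = powConj a y * n ^ ((1 + a) / (1 - a)) := by
  unfold powConj
  have : y * n ^ (1 + a) * a ^ a = (y * a ^ a) * n ^ (1 + a) := by ring
  rw [this, Real.mul_rpow (by positivity) (by positivity), ← Real.rpow_mul hn, mul_one_div]
  ring

theorem powConj_pos {a R : ℝ} (ha : 0 < a) (ha1 : a < 1) (hR : 0 < R) : 0 < powConj a R := by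
  have : 0 < 1 - a := by linarith
  unfold powConj; positivity

theorem continuous_powConj {a : ℝ} (ha1 : a < 1) : Continuous (powConj a) := by
  have : 0 ≤ 1 / (1 - a) := by have : 0 < 1 - a := by linarith
                               positivity
  exact continuous_const.mul
    ((continuous_id.mul continuous_const).rpow_const fun _ => Or.inr this)

/-! ### The expansion of `x f(1 - x)` near zero. -/

/-- The little-o error costs `ε/2` of the coefficient; the other `ε/2` absorbs the terms quadratic
in `x ^ q`, which is why `x ^ q < σ ε / (16 l)` is required. -/
theorem exists_sq_bounds {f : ℝ → ℝ} {σ l q : ℝ} (hσ : 0 < σ) (hl : 0 < l) (hq : 0 < q)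
    (h : (fun s : ℝ => (1 - s) * f s - (σ - l * (1 - s) ^ q))
      =o[𝓝[<] 1] fun s : ℝ => (1 - s) ^ q) {ε : ℝ} (hε : 0 < ε) (hε1 : ε < 1) :
    ∃ δ > 0, ∀ x, 0 < x → x < δ →
      σ ^ 2 ≤ (x * f (1 - x)) ^ 2 * (1 + 2 * l / σ * (1 + ε) * x ^ q) ∧
      (x * f (1 - x)) ^ 2 ≤ σ ^ 2 - 2 * σ * l * (1 - ε) * x ^ q := by
  have ht : Tendsto (fun x : ℝ => 1 - x) (𝓝[>] 0) (𝓝[<] 1) := by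
    refine tendsto_nhdsWithin_iff.2 ⟨?_, ?_⟩
    · have : Continuous fun x : ℝ => 1 - x := by fun_prop
      simpa using (this.tendsto 0).mono_left nhdsWithin_le_nhds
    · filter_upwards [self_mem_nhdsWithin] with x hx
      simpa using hx
  have h1 := ht.eventually (h.bound (show 0 < l * (ε / 2) by positivity))
  have h2 : ∀ᶠ x : ℝ in 𝓝[>] 0, x ^ q < σ * ε / (16 * l) := by
    have : Continuous fun x : ℝ => x ^ q := continuous_id.rpow_const fun _ => Or.inr hq.le
    have h3 := (this.tendsto 0).mono_left (nhdsWithin_le_nhds (s := Set.Ioi 0))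
    simp only [Real.zero_rpow hq.ne'] at h3
    exact h3.eventually_lt_const (by positivity)
  obtain ⟨δ, hδ, hs⟩ := mem_nhdsGT_iff_exists_Ioo_subset.1 (h1.and h2)
  refine ⟨δ, hδ, fun x hx hxδ => ?_⟩
  obtain ⟨h3, h4⟩ := hs ⟨hx, hxδ⟩
  simp only [sub_sub_cancel, Real.norm_eq_abs] at h3
  set X := x ^ q
  have hX : 0 < X := by positivity
  rw [abs_of_pos hX, abs_le] at h3
  set H := x * f (1 - x)
  rw [lt_div_iff₀ (by positivity)] at h4
  have hY : l * X < σ * ε / 16 := by linarith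
  set Y := l * X with hYdef
  have hY0 : 0 < Y := by positivity
  have h5 : H ≤ σ - (1 - ε / 2) * Y := by linarith [h3.2]
  have h6 : σ - (1 + ε / 2) * Y ≤ H := by linarith [h3.1]
  have hσε : σ * ε ≤ σ := by nlinarith
  have h7 : 0 ≤ σ - (1 + ε / 2) * Y := by nlinarith
  constructor
  · have h8 : σ ^ 2 - 2 * σ * ((1 + ε / 2) * Y) ≤ H ^ 2 := by
      have := pow_le_pow_left₀ h7 h6 2
      nlinarith [sq_nonneg ((1 + ε / 2) * Y)]
    have e : 2 * l / σ * (1 + ε) * X = 2 * (1 + ε) * Y / σ := by rw [hYdef]; field_simp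
    rw [e]
    calc σ ^ 2 ≤ (σ ^ 2 - 2 * σ * ((1 + ε / 2) * Y)) * (1 + 2 * (1 + ε) * Y / σ) := by
          have : (σ ^ 2 - 2 * σ * ((1 + ε / 2) * Y)) * (1 + 2 * (1 + ε) * Y / σ) - σ ^ 2
              = Y * (σ * ε - 4 * (1 + ε / 2) * (1 + ε) * Y) := by field_simp; ring
          have h9 : 0 ≤ σ * ε - 4 * (1 + ε / 2) * (1 + ε) * Y := by
            have : (1 + ε / 2) * (1 + ε) ≤ 3 := by nlinarith
            nlinarith
          nlinarith [mul_nonneg hY0.le h9]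
      _ ≤ _ := by gcongr
  · have h0 : 0 ≤ H := h7.trans h6
    have h8 := pow_le_pow_left₀ h0 h5 2
    have h9 : (1 - ε / 2) ^ 2 * Y ≤ σ * ε := by
      have : (1 - ε / 2) ^ 2 ≤ 1 := by nlinarith
      nlinarith
    have e : 2 * σ * l * (1 - ε) * X = 2 * σ * (1 - ε) * Y := by rw [hYdef]; ring
    rw [e]
    nlinarith [mul_le_mul_of_nonneg_right h9 hY0.le]

/-! ### The lower bound. -/

theorem ofReal_le_stiffness_mul_add {f : ℝ → ℝ} {σ k q δ θ : ℝ} (hσ : 0 < σ) (hk : 0 ≤ k)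
    (hθ : 0 ≤ θ)
    (hA : ∀ x, 0 < x → x < δ → σ ^ 2 ≤ (x * f (1 - x)) ^ 2 * (1 + k * x ^ q))
    {b : ℝ} (a : ℝ) (hb : b ≤ 1) (hbδ : 1 - b < δ) :
    ENNReal.ofReal (2 * θ * |a|) ≤ stiffness f b * ENNReal.ofReal (a ^ 2)
      + ENNReal.ofReal (θ ^ 2 / σ ^ 2 * ((1 - b) ^ 2 * (1 + k * (1 - b) ^ q))) := by
  unfold stiffness
  rcases hb.lt_or_eq with h1 | h1
  · rw [if_pos h1]
    have hx : 0 < 1 - b := by linarith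
    have h2 := hA (1 - b) hx hbδ
    rw [sub_sub_cancel] at h2
    set x := 1 - b
    have hX : 0 < x ^ q := by positivity
    set K := 1 + k * x ^ q with hK
    have hK0 : 0 < K := by positivity
    rw [← ENNReal.ofReal_mul (sq_nonneg _), ← ENNReal.ofReal_add (by positivity) (by positivity)]
    refine ENNReal.ofReal_le_ofReal ?_
    -- AM–GM in squared form: `(2θ|a|)² ≤ 4PQ ≤ (P + Q)²`.
    refine (sq_le_sq₀ (by positivity) (by positivity)).1 ?_
    set P := f b ^ 2 * a ^ 2
    set Q := θ ^ 2 / σ ^ 2 * (x ^ 2 * K)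
    have h3 : (θ * |a|) ^ 2 ≤ P * Q := by
      have e : P * Q = (θ * a) ^ 2 / σ ^ 2 * ((x * f b) ^ 2 * K) := by simp only [P, Q]; ring
      rw [e, mul_pow, sq_abs, ← mul_pow]
      calc (θ * a) ^ 2 = (θ * a) ^ 2 / σ ^ 2 * σ ^ 2 := by field_simp
        _ ≤ _ := by gcongr
    nlinarith [sq_nonneg (P - Q)]
  · rw [if_neg h1.not_lt]
    rcases eq_or_ne a 0 with h2 | h2
    · simp [h2]
    · have : ENNReal.ofReal (a ^ 2) ≠ 0 := by
        simp only [ne_eq, ENNReal.ofReal_eq_zero, not_le]; positivity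
      rw [ENNReal.top_mul this]; simp

theorem IsAdmissible.isProfile_of_energy_le {f α α' β β' : ℝ → ℝ} {s E : ℝ}
    (h : IsAdmissible s α α' β β') (hE : 0 ≤ E)
    (hle : profileEnergy f α' β β' ≤ ENNReal.ofReal E) :
    IsProfile (fun t => 1 - β t) (fun t => -β' t) ∧
    (∫⁻ t, stiffness f (β t) * ENNReal.ofReal (α' t ^ 2)) +
      ENNReal.ofReal ((∫ t, (1 - β t) ^ 2) / 4) + ENNReal.ofReal (∫ t, (-β' t) ^ 2)
        = profileEnergy f α' β β' ∧
    ∫ t, (1 - β t) ^ 2 ≤ 4 * E ∧ ∫ t, (-β' t) ^ 2 ≤ E := by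
  have hβ := h.h1_snd.continuous
  have hβ' := h.h1_snd.memL2Loc_deriv.locallyIntegrable.aestronglyMeasurable
  have m1 : AEMeasurable fun t => ENNReal.ofReal ((1 - β t) ^ 2 / 4) :=
    ENNReal.measurable_ofReal.comp_aemeasurable (Continuous.aemeasurable (by fun_prop))
  have m2 : AEMeasurable fun t => ENNReal.ofReal (β' t ^ 2) :=
    ENNReal.measurable_ofReal.comp_aemeasurable (hβ'.aemeasurable.pow_const 2)
  have hs : profileEnergy f α' β β' = (∫⁻ t, stiffness f (β t) * ENNReal.ofReal (α' t ^ 2)) +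
      (∫⁻ t, ENNReal.ofReal ((1 - β t) ^ 2 / 4)) + ∫⁻ t, ENNReal.ofReal (β' t ^ 2) := by
    -- Only the last two summands need to be measurable here; nothing is known about the stiffness
    -- term.
    rw [profileEnergy, lintegral_add_right' _ m2, lintegral_add_right' _ m1]
  have l1 : ∫⁻ t, ENNReal.ofReal ((1 - β t) ^ 2 / 4) ≤ ENNReal.ofReal E := by
    refine le_trans ?_ hle
    rw [hs]; exact le_add_right le_add_self
  have l2 : ∫⁻ t, ENNReal.ofReal (β' t ^ 2) ≤ ENNReal.ofReal E := by
    refine le_trans ?_ hle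
    rw [hs]; exact le_add_self
  have i1 : Integrable fun t => (1 - β t) ^ 2 / 4 := by
    refine (lintegral_ofReal_ne_top_iff_integrable
      (Continuous.aestronglyMeasurable (by fun_prop)) (ae_of_all _ fun t => ?_)).1
      (l1.trans_lt ENNReal.ofReal_lt_top).ne
    change 0 ≤ (1 - β t) ^ 2 / 4
    positivity
  have i2 : Integrable fun t => β' t ^ 2 :=
    (lintegral_ofReal_ne_top_iff_integrable (hβ'.pow 2) (ae_of_all _ fun t => sq_nonneg _)).1
      (l2.trans_lt ENNReal.ofReal_lt_top).ne
  rw [← ofReal_integral_eq_lintegral_ofReal i1 (ae_of_all _ fun t => by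
    change 0 ≤ (1 - β t) ^ 2 / 4; positivity), integral_div] at hs l1
  rw [← ofReal_integral_eq_lintegral_ofReal i2 (ae_of_all _ fun t => sq_nonneg _)] at hs l2
  have hn : ∀ t, (-β' t) ^ 2 = β' t ^ 2 := fun t => neg_sq _
  refine ⟨⟨h.h1_snd.one_sub, fun t => sub_nonneg.2 (h.mem_Icc t).2, ?_, ?_, ?_⟩, ?_, ?_, ?_⟩
  · simpa using h.tendsto_one.const_sub 1
  · simpa using i1.mul_const 4
  · simpa using i2
  · simp_rw [hn]; exact hs.symm
  · have := (ENNReal.ofReal_le_ofReal_iff hE).1 l1; linarith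
  · simp_rw [hn]; exact (ENNReal.ofReal_le_ofReal_iff hE).1 l2

/-- The pointwise inequality, integrated. The parameter `θ` stays free because two values are used:
one for the energy, one to control `N`. -/
theorem IsAdmissible.two_mul_opening_le {f α α' β β' : ℝ → ℝ} {s E σ k q δ θ : ℝ} (hσ : 0 < σ)
    (hk : 0 ≤ k) (hq : 0 < q) (hθ : 0 ≤ θ)
    (hA : ∀ x, 0 < x → x < δ → σ ^ 2 ≤ (x * f (1 - x)) ^ 2 * (1 + k * x ^ q))
    (h : IsAdmissible s α α' β β') (hE : 0 ≤ E)
    (hle : profileEnergy f α' β β' ≤ ENNReal.ofReal E) (hδ : ∀ t, 1 - β t < δ) :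
    2 * θ * s + (∫ t, (1 - β t) ^ 2) / 4 + ∫ t, (-β' t) ^ 2
      ≤ (profileEnergy f α' β β').toReal
        + θ ^ 2 / σ ^ 2 * ((∫ t, (1 - β t) ^ 2) + k * ∫ t, (1 - β t) ^ (2 + q)) := by
  obtain ⟨hp, hs, -, -⟩ := h.isProfile_of_energy_le hE hle
  have hfin : profileEnergy f α' β β' ≠ ⊤ := (hle.trans_lt ENNReal.ofReal_lt_top).ne
  have hN : 0 ≤ ∫ t, (1 - β t) ^ 2 := integral_nonneg fun t => sq_nonneg _
  have hD : 0 ≤ ∫ t, (-β' t) ^ 2 := integral_nonneg fun t => sq_nonneg _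
  set N := ∫ t, (1 - β t) ^ 2
  set D := ∫ t, (-β' t) ^ 2
  set F := ∫⁻ t, stiffness f (β t) * ENNReal.ofReal (α' t ^ 2)
  have hF : F ≠ ⊤ := fun h0 => hfin (by rw [← hs, h0]; simp)
  have hEF : (profileEnergy f α' β β').toReal = F.toReal + N / 4 + D := by
    rw [← hs, ENNReal.toReal_add (by simp [hF]) (by simp), ENNReal.toReal_add hF (by simp),
      ENNReal.toReal_ofReal (by positivity), ENNReal.toReal_ofReal hD]
  set W : ℝ → ℝ := fun t => θ ^ 2 / σ ^ 2 * ((1 - β t) ^ 2 * (1 + k * (1 - β t) ^ q)) with hW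
  have hW0 : ∀ t, 0 ≤ W t := fun t => by
    have := hp.nonneg t
    simp only [hW]; positivity
  have hWe : W = fun t => θ ^ 2 / σ ^ 2 * ((1 - β t) ^ 2 + k * (1 - β t) ^ (2 + q)) := by
    ext t
    rw [hp.rpow_two_add hq t]; simp only [hW]; ring
  have i1 := (hp.integrable_rpow hq).const_mul k
  have hWi : Integrable W := by
    rw [hWe]; exact (hp.integrable_sq.add i1).const_mul _
  have hWint : ∫ t, W t = θ ^ 2 / σ ^ 2 * (N + k * ∫ t, (1 - β t) ^ (2 + q)) := by
    rw [hWe, integral_const_mul, integral_add hp.integrable_sq i1, integral_const_mul]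
  have hWint0 : 0 ≤ ∫ t, W t := integral_nonneg hW0
  have key : ENNReal.ofReal (∫ t, 2 * θ * |α' t|) ≤ F + ENNReal.ofReal (∫ t, W t) := by
    rw [ofReal_integral_eq_lintegral_ofReal (h.integrable.abs.const_mul _)
      (ae_of_all _ fun t => by change 0 ≤ 2 * θ * |α' t|; positivity),
      ofReal_integral_eq_lintegral_ofReal hWi (ae_of_all _ hW0),
      ← lintegral_add_right' _ (hWi.aemeasurable.ennreal_ofReal)]
    exact lintegral_mono fun t =>
      ofReal_le_stiffness_mul_add hσ hk hθ hA _ (h.mem_Icc t).2 (hδ t)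
  have hsle : s ≤ ∫ t, |α' t| := h.opening ▸ abs_integral_le_integral_abs
  rw [← ENNReal.ofReal_toReal hF, ← ENNReal.ofReal_add (by positivity) hWint0,
    ENNReal.ofReal_le_ofReal_iff (by positivity), integral_const_mul, hWint] at key
  have : 2 * θ * s ≤ 2 * θ * ∫ t, |α' t| := by gcongr
  rw [hEF]
  linarith

theorem le_cohesiveInf {f : ℝ → ℝ} {σ l q ε δ G s : ℝ} (hσ : 0 < σ) (hl : 0 < l) (hq : 0 < q)
    (hq4 : q < 4) (hε : 0 < ε) (hε1 : ε < 1) (hδ : 0 < δ) (hG0 : 0 < G)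
    (hA : ∀ x, 0 < x → x < δ →
      σ ^ 2 ≤ (x * f (1 - x)) ^ 2 * (1 + 2 * l / σ * (1 + ε) * x ^ q))
    (hG : ∀ x x', IsProfile x x' → ∫ t, x t ^ (2 + q)
      ≤ G * (∫ t, x' t ^ 2) ^ (q / 4) * (∫ t, x t ^ 2) ^ (1 + q / 4))
    (hs : 0 < s) (hsδ : 8 * σ * s < δ ^ 2)
    (hsε : 2 * l / σ * (1 + ε) * (8 * σ * s) ^ (q / 2) ≤ ε ^ 2) :
    ENNReal.ofReal (σ * s - powConj (q / 4) (l / (2 * σ) * (1 + ε) * G)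
      * (2 * σ / (1 - ε) * s) ^ ((1 + q / 4) / (1 - q / 4))) ≤ cohesiveInf f s := by
  have ha : 0 < q / 4 := by positivity
  have ha1 : 0 < 1 - q / 4 := by linarith
  have hε' : 0 < 1 - ε := by linarith
  set Λ := powConj (q / 4) (l / (2 * σ) * (1 + ε) * G) with hΛ
  have hΛ0 : 0 < Λ := powConj_pos ha (by linarith) (by positivity)
  refine le_iInf fun α => le_iInf fun α' => le_iInf fun β => le_iInf fun β' => le_iInf fun h => ?_
  -- Competitors with energy at least `σ s` satisfy the bound trivially; the others have `N ≤ 4σs`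
  -- and `D ≤ σs`, hence are uniformly close to `β = 1`.
  rcases le_total (ENNReal.ofReal (σ * s)) (profileEnergy f α' β β') with hE | hE
  · refine le_trans (ENNReal.ofReal_le_ofReal ?_) hE
    have : 0 ≤ Λ * (2 * σ / (1 - ε) * s) ^ ((1 + q / 4) / (1 - q / 4)) := by positivity
    linarith
  have hσs : 0 ≤ σ * s := by positivity
  obtain ⟨hp, -, hN4, hD1⟩ := h.isProfile_of_energy_le hσs hE
  have hfin : profileEnergy f α' β β' ≠ ⊤ := (hE.trans_lt ENNReal.ofReal_lt_top).ne
  have hEr : (profileEnergy f α' β β').toReal ≤ σ * s := ENNReal.toReal_le_of_le_ofReal hσs hE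
  have hsq : ∀ t, (1 - β t) ^ 2 ≤ 8 * σ * s := fun t => by
    refine (sq_le_sqrt_mul_sqrt hp.h1 hp.integrable_sq hp.integrable_sq_deriv t).trans ?_
    calc _ ≤ 4 * √(4 * (σ * s)) * √(σ * s) := by gcongr
      _ = 8 * σ * s := by
        rw [Real.sqrt_mul (by norm_num), show (4 : ℝ) = 2 ^ 2 by norm_num,
          Real.sqrt_sq (by norm_num)]
        nlinarith [Real.mul_self_sqrt hσs]
  have hβδ : ∀ t, 1 - β t < δ := fun t => lt_of_pow_lt_pow_left₀ 2 hδ.le ((hsq t).trans_lt hsδ)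
  set k := 2 * l / σ * (1 + ε) with hk
  have hk0 : 0 < k := by positivity
  -- This value makes the two terms `N / 4` cancel.
  have h1 := h.two_mul_opening_le hσ hk0.le hq (θ := σ / 2) (by positivity) hA hσs hE hβδ
  -- A slightly smaller `θ` leaves a multiple of `ε N` on the left and costs only `ε σ s`, which
  -- yields `N ≤ 2σs / (1 - ε)`. The error `k C ≤ ε² N` is of lower order in `ε`.
  have h2 := h.two_mul_opening_le hσ hk0.le hq (θ := (1 - ε) * σ / 2) (by positivity) hA hσs hE hβδ
  have hN0 : 0 ≤ ∫ t, (1 - β t) ^ 2 := integral_nonneg fun t => sq_nonneg _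
  have hD0 : 0 ≤ ∫ t, (-β' t) ^ 2 := integral_nonneg fun t => sq_nonneg _
  have hkC : k * ∫ t, (1 - β t) ^ (2 + q) ≤ ε ^ 2 * ∫ t, (1 - β t) ^ 2 := by
    rw [← integral_const_mul, ← integral_const_mul]
    refine integral_mono ((hp.integrable_rpow hq).const_mul _) (hp.integrable_sq.const_mul _)
      fun t => ?_
    have h3 : (1 - β t) ^ q ≤ (8 * σ * s) ^ (q / 2) := by
      have h4 := Real.rpow_le_rpow (sq_nonneg _) (hsq t) (z := q / 2) (by positivity)
      rwa [← Real.rpow_natCast, ← Real.rpow_mul (hp.nonneg t), Nat.cast_ofNat,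
        mul_div_cancel₀ _ two_ne_zero] at h4
    simp only
    rw [hp.rpow_two_add hq t]
    calc k * ((1 - β t) ^ 2 * (1 - β t) ^ q) ≤ k * ((1 - β t) ^ 2 * (8 * σ * s) ^ (q / 2)) := by
          gcongr
      _ = (k * (8 * σ * s) ^ (q / 2)) * (1 - β t) ^ 2 := by ring
      _ ≤ _ := by gcongr
  have hGN := hG _ _ hp
  set N := ∫ t, (1 - β t) ^ 2
  set D := ∫ t, (-β' t) ^ 2
  set C := ∫ t, (1 - β t) ^ (2 + q)
  set E := (profileEnergy f α' β β').toReal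
  have hN : N ≤ 2 * σ / (1 - ε) * s := by
    have e : ((1 - ε) * σ / 2) ^ 2 / σ ^ 2 = (1 - ε) ^ 2 / 4 := by
      field_simp; norm_num
    rw [e] at h2
    have h5 : (1 - ε) ^ 2 / 4 * (N + k * C) ≤ (1 - ε) ^ 2 / 4 * (N + ε ^ 2 * N) := by gcongr
    have h6 : N / 4 - (1 - ε) ^ 2 / 4 * (N + ε ^ 2 * N) ≤ ε * (σ * s) := by linarith
    have h7 : ε * (1 - ε) / 2 * N ≤ N / 4 - (1 - ε) ^ 2 / 4 * (N + ε ^ 2 * N) := by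
      have : 0 ≤ N * ε ^ 3 * (2 - ε) := by
        have : 0 ≤ 2 - ε := by linarith
        positivity
      nlinarith
    have h8 : ε * ((1 - ε) * N) ≤ ε * (2 * σ * s) := by linarith
    have h9 := le_of_mul_le_mul_left h8 hε
    rw [div_mul_eq_mul_div, le_div_iff₀ hε']
    linarith
  have hE2 : σ * s + D - l / (2 * σ) * (1 + ε) * C ≤ E := by
    have e : (σ / 2) ^ 2 / σ ^ 2 = 1 / 4 := by
      rw [div_pow, div_right_comm, div_self (by positivity)]; norm_num
    rw [e] at h1
    have : 1 / 4 * (k * C) = l / (2 * σ) * (1 + ε) * C := by rw [hk]; field_simp; ring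
    linarith
  have hopt := mul_rpow_sub_le_powConj ha (by linarith)
    (R := l / (2 * σ) * (1 + ε) * G * N ^ (1 + q / 4)) (by positivity) hD0
  rw [powConj_mul_rpow ha (by positivity) hN0] at hopt
  have h10 : l / (2 * σ) * (1 + ε) * C
      ≤ l / (2 * σ) * (1 + ε) * G * N ^ (1 + q / 4) * D ^ (q / 4) := by
    calc _ ≤ l / (2 * σ) * (1 + ε) * (G * D ^ (q / 4) * N ^ (1 + q / 4)) := by gcongr
      _ = _ := by ring
  have h11 : Λ * N ^ ((1 + q / 4) / (1 - q / 4))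
      ≤ Λ * (2 * σ / (1 - ε) * s) ^ ((1 + q / 4) / (1 - q / 4)) := by gcongr
  rw [ENNReal.ofReal_le_iff_le_toReal hfin]
  linarith

/-! ### The upper bound. -/

theorem IsProfile.cohesiveInf_le {f x x' : ℝ → ℝ} {σ l q ε δ s : ℝ} (hσ : 0 < σ) (hq : 0 < q)
    (h : IsProfile x x') (hδ1 : δ ≤ 1)
    (hB : ∀ y, 0 < y → y < δ → (y * f (1 - y)) ^ 2 ≤ σ ^ 2 - 2 * σ * l * (1 - ε) * y ^ q)
    (hs : 0 < s) (hN : ∫ t, x t ^ 2 = 2 * σ * s) (hx : ∀ t, x t < δ) :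
    cohesiveInf f s ≤ ENNReal.ofReal (σ * s - l / (2 * σ) * (1 - ε) * (∫ t, x t ^ (2 + q))
      + ∫ t, x' t ^ 2) := by
  have hc := h.h1.continuous
  -- The equality case `α' = θ / f²` at `θ = σ / 2`, with `f` replaced by its leading term `σ / x`.
  -- It vanishes where `β = 1`, so the infinite stiffness there costs nothing.
  set a : ℝ → ℝ := fun t => x t ^ 2 / (2 * σ) with ha
  have hac : Continuous a := (hc.pow 2).div_const _
  have hadm : IsAdmissible s (fun t => ∫ r in (0 : ℝ)..t, a r) a
      (fun t => 1 - x t) (fun t => -x' t) := by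
    refine ⟨isH1Loc_of_hasDerivAt (fun t => (hac.integral_hasStrictDerivAt 0 t).hasDerivAt) hac,
      h.h1.one_sub, h.integrable_sq.div_const _, ?_, fun t => ?_, ?_⟩
    · rw [ha, integral_div, hN, mul_div_cancel_left₀ _ (by positivity), abs_of_pos hs]
    · have := h.nonneg t
      have := hx t
      constructor <;> linarith
    · simpa using h.tendsto_zero.const_sub 1
  have hinf : cohesiveInf f s ≤ profileEnergy f a (fun t => 1 - x t) (fun t => -x' t) :=
    iInf_le_of_le _ <| iInf_le_of_le _ <| iInf_le_of_le _ <| iInf_le_of_le _ <|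
      iInf_le_of_le hadm le_rfl
  refine hinf.trans ?_
  have i1 := h.integrable_sq
  have i2 := (h.integrable_rpow hq).const_mul (l / (2 * σ) * (1 - ε))
  have i3 := h.integrable_sq_deriv
  set W : ℝ → ℝ := fun t => 1 / 2 * x t ^ 2 - l / (2 * σ) * (1 - ε) * x t ^ (2 + q) + x' t ^ 2
    with hW
  have hWi : Integrable W := ((i1.const_mul (1 / 2)).sub i2).add i3
  have hWint : ∫ t, W t = σ * s - l / (2 * σ) * (1 - ε) * (∫ t, x t ^ (2 + q))
      + ∫ t, x' t ^ 2 := by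
    have i4 : Integrable fun t => 1 / 2 * x t ^ 2 - l / (2 * σ) * (1 - ε) * x t ^ (2 + q) :=
      (i1.const_mul (1 / 2)).sub i2
    rw [hW, integral_add i4 i3, integral_sub (i1.const_mul _) i2,
      integral_const_mul, integral_const_mul, hN]
    ring
  have hpt : ∀ t, stiffness f (1 - x t) * ENNReal.ofReal (a t ^ 2)
      + ENNReal.ofReal ((1 - (1 - x t)) ^ 2 / 4) + ENNReal.ofReal ((-x' t) ^ 2)
        ≤ ENNReal.ofReal (W t) ∧ 0 ≤ W t := fun t => by
    rcases (h.nonneg t).eq_or_lt with h0 | h0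
    · have e : W t = x' t ^ 2 := by
        simp [hW, ← h0, Real.zero_rpow (show 2 + q ≠ 0 by positivity)]
      rw [e]
      refine ⟨?_, sq_nonneg _⟩
      simp [ha, ← h0]
    · have hb := hB (x t) h0 (hx t)
      have hle : f (1 - x t) ^ 2 * a t ^ 2 + (1 - (1 - x t)) ^ 2 / 4 + (-x' t) ^ 2 ≤ W t := by
        have e : f (1 - x t) ^ 2 * a t ^ 2
            = x t ^ 2 / (4 * σ ^ 2) * (x t * f (1 - x t)) ^ 2 := by
          simp only [ha]; field_simp; ring
        have h1 : f (1 - x t) ^ 2 * a t ^ 2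
            ≤ x t ^ 2 / 4 - l / (2 * σ) * (1 - ε) * (x t ^ 2 * x t ^ q) := by
          rw [e]
          calc _ ≤ x t ^ 2 / (4 * σ ^ 2) * (σ ^ 2 - 2 * σ * l * (1 - ε) * x t ^ q) := by gcongr
            _ = _ := by field_simp; ring
        simp only [hW]
        rw [h.rpow_two_add hq t]
        linarith
      have hsf : stiffness f (1 - x t) = ENNReal.ofReal (f (1 - x t) ^ 2) := by
        rw [stiffness, if_pos (by linarith)]
      rw [hsf, ← ENNReal.ofReal_mul (sq_nonneg _), ← ENNReal.ofReal_add (by positivity)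
        (by positivity), ← ENNReal.ofReal_add (by positivity) (by positivity)]
      exact ⟨ENNReal.ofReal_le_ofReal hle, le_trans (by positivity) hle⟩
  rw [← hWint, ofReal_integral_eq_lintegral_ofReal hWi (ae_of_all _ fun t => (hpt t).2)]
  exact lintegral_mono fun t => (hpt t).1

/-- Both sides of Gagliardo–Nirenberg scale alike under `c x(m ·)`, and the two parameters can be
tuned to reach any positive `N` and `D`. -/
theorem IsProfile.exists_rescaled {x x' : ℝ → ℝ} {q G N D : ℝ} (h : IsProfile x x')
    (hN0 : 0 < ∫ t, x t ^ 2) (hD0 : 0 < ∫ t, x' t ^ 2)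
    (hG : G * (∫ t, x' t ^ 2) ^ (q / 4) * (∫ t, x t ^ 2) ^ (1 + q / 4) < ∫ t, x t ^ (2 + q))
    (hN : 0 < N) (hD : 0 < D) :
    ∃ y y', IsProfile y y' ∧ ∫ t, y t ^ 2 = N ∧ ∫ t, y' t ^ 2 = D ∧
      G * D ^ (q / 4) * N ^ (1 + q / 4) < ∫ t, y t ^ (2 + q) := by
  set N0 := ∫ t, x t ^ 2
  set D0 := ∫ t, x' t ^ 2
  set m := √(D * N0 / (N * D0)) with hm
  set c := √(N * m / N0) with hc
  have hm0 : 0 < m := by positivity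
  have hc0 : 0 < c := by positivity
  have hm2 : m ^ 2 = D * N0 / (N * D0) := Real.sq_sqrt (by positivity)
  have hc2 : c ^ 2 = N * m / N0 := Real.sq_sqrt (by positivity)
  have eN : c ^ 2 / m * N0 = N := by rw [hc2]; field_simp
  have eD : (c * m) ^ 2 / m * D0 = D := by
    have : (c * m) ^ 2 / m * D0 = c ^ 2 * m * D0 := by field_simp
    rw [this, hc2]
    have : N * m / N0 * m * D0 = N / N0 * D0 * m ^ 2 := by ring
    rw [this, hm2]; field_simp
  refine ⟨_, _, h.scale hc0 hm0, ?_, ?_, ?_⟩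
  · rw [IsProfile.integral_scale hm0, eN]
  · rw [IsProfile.integral_scale hm0, eD]
  · rw [h.integral_rpow_scale hc0 hm0]
    have e : c ^ (2 + q) / m = ((c * m) ^ 2 / m) ^ (q / 4) * (c ^ 2 / m) ^ (1 + q / 4) := by
      have e1 : (c * m) ^ 2 / m = c ^ 2 * m := by field_simp
      rw [e1, Real.mul_rpow (by positivity) hm0.le, Real.div_rpow (by positivity) hm0.le,
        Real.rpow_add hm0, Real.rpow_one]
      have e2 : c ^ (2 + q) = (c ^ 2) ^ (q / 4) * (c ^ 2) ^ (1 + q / 4) := by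
        rw [← Real.rpow_natCast, ← Real.rpow_mul hc0.le, ← Real.rpow_mul hc0.le,
          ← Real.rpow_add hc0]
        congr 1; push_cast; ring
      rw [e2]
      field_simp
    calc G * D ^ (q / 4) * N ^ (1 + q / 4)
        = c ^ (2 + q) / m * (G * D0 ^ (q / 4) * N0 ^ (1 + q / 4)) := by
          rw [e, ← eN, ← eD, Real.mul_rpow (by positivity) hD0.le,
            Real.mul_rpow (by positivity) hN0.le]
          ring
      _ < _ := by gcongr

theorem cohesiveInf_le {f : ℝ → ℝ} {σ l q ε δ G s : ℝ} (hσ : 0 < σ) (hl : 0 < l) (hq : 0 < q)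
    (hq4 : q < 4) (hε1 : ε < 1) (hδ : 0 < δ) (hδ1 : δ ≤ 1) (hG0 : 0 < G)
    (hB : ∀ y, 0 < y → y < δ → (y * f (1 - y)) ^ 2 ≤ σ ^ 2 - 2 * σ * l * (1 - ε) * y ^ q)
    (hG : ∃ x x', IsProfile x x' ∧ 0 < ∫ t, x t ^ 2 ∧ 0 < ∫ t, x' t ^ 2 ∧
      G * (∫ t, x' t ^ 2) ^ (q / 4) * (∫ t, x t ^ 2) ^ (1 + q / 4) < ∫ t, x t ^ (2 + q))
    (hs : 0 < s)
    (hsδ : 4 * √(2 * σ * s) * √(q / 4 * (l / (2 * σ) * (1 - ε) * G * (2 * σ * s) ^ (1 + q / 4)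
      * (q / 4) ^ (q / 4)) ^ (1 / (1 - q / 4))) < δ ^ 2) :
    cohesiveInf f s ≤ ENNReal.ofReal (σ * s - powConj (q / 4) (l / (2 * σ) * (1 - ε) * G)
      * (2 * σ * s) ^ ((1 + q / 4) / (1 - q / 4))) := by
  obtain ⟨x, x', hx, hN0, hD0, hxG⟩ := hG
  have ha : 0 < q / 4 := by positivity
  have hε' : 0 < 1 - ε := by linarith
  have hk : 0 < l / (2 * σ) * (1 - ε) := by positivity
  have hN : 0 < 2 * σ * s := by positivity
  set N := 2 * σ * s with hNdef
  have hR : 0 < l / (2 * σ) * (1 - ε) * G * N ^ (1 + q / 4) := by positivity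
  have hopt := mul_rpow_sub_eq_powConj ha (by linarith) hR
  set R := l / (2 * σ) * (1 - ε) * G * N ^ (1 + q / 4) with hRdef
  set D := q / 4 * (R * (q / 4) ^ (q / 4)) ^ (1 / (1 - q / 4)) with hDdef
  have hD : 0 < D := by positivity
  obtain ⟨y, y', hy, hyN, hyD, hyG⟩ := hx.exists_rescaled hN0 hD0 hxG hN hD
  have hsup : ∀ t, y t < δ := fun t => by
    have h1 := sq_le_sqrt_mul_sqrt hy.h1 hy.integrable_sq hy.integrable_sq_deriv t
    rw [hyN, hyD] at h1
    exact lt_of_pow_lt_pow_left₀ 2 hδ.le (h1.trans_lt hsδ)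
  refine (hy.cohesiveInf_le hσ hq hδ1 hB hs hyN hsup).trans (ENNReal.ofReal_le_ofReal ?_)
  rw [hRdef, powConj_mul_rpow ha (by positivity) hN.le] at hopt
  rw [hyD]
  have h2 : R * D ^ (q / 4) ≤ l / (2 * σ) * (1 - ε) * ∫ t, y t ^ (2 + q) := by
    calc R * D ^ (q / 4)
        = l / (2 * σ) * (1 - ε) * (G * D ^ (q / 4) * N ^ (1 + q / 4)) := by rw [hRdef]; ring
      _ ≤ _ := by gcongr
  linarith

/-! ### The expansion of the cohesive density. -/

theorem proposition3p7 (f : ℝ → ℝ) (σc : ℝ) (hf : IsDegradation f σc)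
    (l q : ℝ) (hl : 0 < l) (hq : q ∈ Set.Ioc (0 : ℝ) 2)
    (hasymp : (fun s : ℝ => (1 - s) * f s - (σc - l * (1 - s) ^ q))
      =o[𝓝[<] 1] fun s : ℝ => (1 - s) ^ q) :
    ∃ l' : ℝ, 0 < l' ∧
      (fun s : ℝ => cohesiveDensity f s - (σc * s - l' * s ^ ((4 + q) / (4 - q))))
        =o[𝓝[>] 0] fun s : ℝ => s ^ ((4 + q) / (4 - q)) := by
  obtain ⟨hq0, hq2⟩ := hq
  have hσ := hf.critical_pos
  obtain ⟨G, hG0, hG, hG'⟩ := exists_sharp_constant hq0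
  have ha : 0 < q / 4 := by positivity
  have ha1 : 0 < 1 - q / 4 := by linarith
  have hp : (1 + q / 4) / (1 - q / 4) = (4 + q) / (4 - q) := by
    have : 4 - q ≠ 0 := by linarith
    field_simp
  set p := (4 + q) / (4 - q) with hpdef
  have hp1 : 1 < p := by rw [hpdef, one_lt_div (by linarith)]; linarith
  set κ := l / (2 * σc) with hκ
  have hκ0 : 0 < κ := by positivity
  set l' := powConj (q / 4) (κ * G) * (2 * σc) ^ p with hl'
  have hl'0 : 0 < l' := mul_pos (powConj_pos ha (by linarith) (by positivity)) (by positivity)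
  refine ⟨l', hl'0, ?_⟩
  rw [isLittleO_iff]
  intro η hη
  have hcont := continuous_powConj (a := q / 4) (by linarith)
  -- Both perturbed constants tend to `l'` as `ε → 0`. The factor `G * (1 - ε)` lies strictly below
  -- the best constant, so some profile beats it.
  obtain ⟨ε, hε, hε1, hlow, hup⟩ : ∃ ε : ℝ, 0 < ε ∧ ε < 1 ∧
      powConj (q / 4) (κ * (1 + ε) * G) * (2 * σc / (1 - ε)) ^ p < l' + η ∧
      l' - η < powConj (q / 4) (κ * (1 - ε) * (G * (1 - ε))) * (2 * σc) ^ p := by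
    have c1 : Tendsto (fun ε : ℝ => powConj (q / 4) (κ * (1 + ε) * G)
        * (2 * σc / (1 - ε)) ^ p) (𝓝[>] 0) (𝓝 l') := by
      have : ContinuousAt (fun ε : ℝ => powConj (q / 4) (κ * (1 + ε) * G)
          * (2 * σc / (1 - ε)) ^ p) 0 := by
        refine ContinuousAt.mul (Continuous.continuousAt (hcont.comp (by fun_prop))) ?_
        refine ContinuousAt.rpow_const ?_ (Or.inr (by linarith))
        exact continuousAt_const.div (by fun_prop) (by norm_num)
      have h2 := this.tendsto.mono_left (nhdsWithin_le_nhds (s := Set.Ioi 0))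
      simpa using h2
    have c2 : Tendsto (fun ε : ℝ => powConj (q / 4) (κ * (1 - ε) * (G * (1 - ε)))
        * (2 * σc) ^ p) (𝓝[>] 0) (𝓝 l') := by
      have : Continuous (fun ε : ℝ => powConj (q / 4) (κ * (1 - ε) * (G * (1 - ε)))
          * (2 * σc) ^ p) := (hcont.comp (by fun_prop)).mul continuous_const
      have h2 := (this.tendsto 0).mono_left (nhdsWithin_le_nhds (s := Set.Ioi 0))
      simpa using h2
    have h1 := c1.eventually_lt_const (show l' < l' + η by linarith)
    have h2 := c2.eventually_const_lt (show l' - η < l' by linarith)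
    obtain ⟨ε, ⟨⟨h3, h4⟩, h5⟩, h6⟩ := (((h1.and h2).and (eventually_mem_nhdsWithin)).and
      (eventually_nhdsWithin_of_eventually_nhds (eventually_lt_nhds one_pos))).exists
    exact ⟨ε, h5, h6, h3, h4⟩
  have hε' : 0 < 1 - ε := by linarith
  obtain ⟨δ₀, hδ₀, hAB⟩ := exists_sq_bounds hσ hl hq0 hasymp hε hε1
  -- The cap at `1` keeps `β = 1 - x` nonnegative in the upper bound.
  set δ := min δ₀ 1 with hδdef
  have hδ : 0 < δ := lt_min hδ₀ one_pos
  have hA := fun x h0 (h1 : x < δ) => (hAB x h0 (h1.trans_le (min_le_left _ _))).1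
  have hB := fun x h0 (h1 : x < δ) => (hAB x h0 (h1.trans_le (min_le_left _ _))).2
  have ev : ∀ {F : ℝ → ℝ} {b : ℝ}, Continuous F → F 0 = 0 → 0 < b → ∀ᶠ s in 𝓝[>] 0, F s < b := by
    intro F b hF h0 hb
    have h1 := (hF.tendsto 0).mono_left (nhdsWithin_le_nhds (s := Set.Ioi 0))
    rw [h0] at h1
    exact h1.eventually_lt_const hb
  have e1 := ev (F := fun s => 8 * σc * s) (b := δ ^ 2) (by fun_prop) (by simp) (by positivity)
  have e2 := ev (F := fun s => 2 * l / σc * (1 + ε) * (8 * σc * s) ^ (q / 2)) (b := ε ^ 2)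
    (continuous_const.mul ((by fun_prop : Continuous fun s => 8 * σc * s).rpow_const
      fun _ => Or.inr (by positivity)))
    (by simp [Real.zero_rpow (show q / 2 ≠ 0 by positivity)]) (by positivity)
  have e3 := ev (F := fun s => 4 * √(2 * σc * s) * √(q / 4 * (κ * (1 - ε) * (G * (1 - ε))
      * (2 * σc * s) ^ (1 + q / 4) * (q / 4) ^ (q / 4)) ^ (1 / (1 - q / 4)))) (b := δ ^ 2)
    (by
      refine Continuous.mul (by fun_prop) (Continuous.sqrt (continuous_const.mul ?_))
      refine Continuous.rpow_const (Continuous.mul (continuous_const.mul ?_) continuous_const)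
        fun _ => Or.inr (by positivity)
      exact Continuous.rpow_const (by fun_prop) fun _ => Or.inr (by positivity))
    (by simp) (by positivity)
  -- Since `p > 1`, the linear term dominates for small `s`; the upper bound is then nonnegative and
  -- survives the passage from `ENNReal.ofReal` to reals.
  have e4 := ev (F := fun s => (l' + η) * s ^ (p - 1)) (b := σc)
    (continuous_const.mul (continuous_id.rpow_const fun _ => Or.inr (by linarith)))
    (by simp [Real.zero_rpow (show p - 1 ≠ 0 by linarith)]) hσ
  filter_upwards [e1, e2, e3, e4, self_mem_nhdsWithin] with s h1 h2 h3 h4 hs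
  have hs : 0 < s := hs
  have hsp : 0 < s ^ p := by positivity
  have L := le_cohesiveInf hσ hl hq0 (by linarith) hε hε1 hδ hG0 hA hG hs h1 h2.le
  have U := cohesiveInf_le hσ hl hq0 (by linarith) hε1 hδ (min_le_right _ _)
    (G := G * (1 - ε)) (by positivity) hB (hG' _ (by nlinarith) (by positivity)) hs h3
  rw [hp, Real.mul_rpow (by positivity) hs.le, ← mul_assoc] at L U
  have hfin : cohesiveInf f s ≠ ⊤ := (U.trans_lt ENNReal.ofReal_lt_top).ne
  have L' := (ENNReal.ofReal_le_iff_le_toReal hfin).1 L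
  have hlow' := mul_le_mul_of_nonneg_right hlow.le hsp.le
  have hup' := mul_le_mul_of_nonneg_right hup.le hsp.le
  have hpos : (l' + η) * s ^ p ≤ σc * s := by
    have : s ^ p = s ^ (p - 1) * s := by
      rw [← Real.rpow_add_one hs.ne', sub_add_cancel]
    rw [this, ← mul_assoc]
    gcongr
  have U' : (cohesiveInf f s).toReal ≤ σc * s - (l' - η) * s ^ p :=
    ENNReal.toReal_le_of_le_ofReal (by nlinarith)
      (U.trans (ENNReal.ofReal_le_ofReal (by linarith)))
  rw [Real.norm_eq_abs, Real.norm_eq_abs, abs_of_pos hsp, abs_le, cohesiveDensity]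
  constructor <;> linarith
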